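/- Let $k$ be an algebraically closed field of characteristic zero; a variety is an algebraic variety over $k$ (a reduced separated scheme of finite type over $k$), its points are its closed points, and $\mathrm{Aut}(X)$ is the group of automorphisms of $X$ over $k$. A group $H$ is called Jordan if there is a positive integer $d$ such that every finite subgroup $K$ of $H$ contains a normal abelian subgroup whose index in $K$ is at most $d$; the least such $d$ is denoted by $J_H$. Let $X$ be an irreducible variety and, for a point $x\in X$, let $\mathrm{T}_{x,X}$ be the tangent space of $X$ at $x$. Then the maximum $$m=\max_{x\in X}\dim_k \mathrm{T}_{x,X}$$ exists, and the following hold. (1) If $G$ is a finite subgroup of $\mathrm{Aut}(X)$ that has a fixed point in $X$ (a point $x$ with $g\cdot x=x$ for all $g\in G$), then $G$ has a normal abelian subgroup whose index in $G$ is at most $J_{\mathbf{GL}_m(k)}$. (2) If every finite subgroup of $\mathrm{Aut}(X)$ has a fixed point in $X$, then $\mathrm{Aut}(X)$ is Jordan and $J_{\mathrm{Aut}(X)}\leqslant J_{\mathbf{GL}_m(k)}$. -/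

import Mathlib

open CategoryTheory AlgebraicGeometry

universe u v

/-- `G` satisfies the Jordan condition with bound `d`: every finite subgroup `K` of `G` contains
a normal abelian subgroup whose index in `K` is at most `d`. -/
def JordanBound (G : Type v) [Group G] (d : ℕ) : Prop :=
  ∀ K : Subgroup G, Finite K →
    ∃ A : Subgroup K, A.Normal ∧ IsMulCommutative A ∧ A.index ≤ d

/-- A group is Jordan if the Jordan condition holds with some positive integer bound. -/
def IsJordanGroup (G : Type v) [Group G] : Prop :=
  ∃ d : ℕ, 0 < d ∧ JordanBound G d

/-- The Jordan constant of `G`: the minimal positive integer `d` for which the Jordan condition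
holds (and the value `0`, smaller than every admissible bound, if `G` is not Jordan). -/
noncomputable def jordanConstant (G : Type v) [Group G] : ℕ :=
  sInf {d : ℕ | 0 < d ∧ JordanBound G d}

/-- An algebraic variety over the field `k`, given by its structure morphism `π : X ⟶ Spec k`:
a reduced separated scheme of finite type over `k`. It need not be irreducible. -/
structure IsAlgebraicVariety {k : Type u} [Field k] {X : Scheme.{u}}
    (π : X ⟶ Spec (.of k)) : Prop where
  isReduced : AlgebraicGeometry.IsReduced X
  isSeparated : IsSeparated π
  locallyOfFiniteType : LocallyOfFiniteType π
  quasiCompact : QuasiCompact π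

/-- The group of automorphisms of `X` over `k`. -/
abbrev VarietyAut {k : Type u} [Field k] {X : Scheme.{u}} (π : X ⟶ Spec (.of k)) : Type u :=
  Aut (Over.mk π)

/-- The action of an automorphism over `k` on the underlying set of the scheme. -/
noncomputable def VarietyAut.act {k : Type u} [Field k] {X : Scheme.{u}}
    {π : X ⟶ Spec (.of k)} (g : VarietyAut π) (x : X) : X :=
  g.hom.left x

/-- The points of the variety in the classical sense: the closed points of the scheme. -/
abbrev VarietyPoint (X : Scheme.{u}) : Type u := closedPoints X

/-- The set of automorphisms `G` has a common fixed point among the points of the variety. -/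
def HasFixedPoint {k : Type u} [Field k] {X : Scheme.{u}} {π : X ⟶ Spec (.of k)}
    (G : Subgroup (VarietyAut π)) : Prop :=
  ∃ x : VarietyPoint X, ∀ g ∈ G, VarietyAut.act g x.1 = x.1

/-- The (Zariski) tangent space of `X` at `x`: the dual of `𝔪 / 𝔪 ^ 2` over the residue field,
where `𝔪` is the maximal ideal of the local ring of `X` at `x`. -/
abbrev ZariskiTangentSpace (X : Scheme.{u}) (x : X) : Type u :=
  Module.Dual (IsLocalRing.ResidueField (X.presheaf.stalk x))
    (IsLocalRing.CotangentSpace (X.presheaf.stalk x))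

/-- The dimension of the tangent space of `X` at `x`. -/
noncomputable def tangentDim (X : Scheme.{u}) (x : X) : ℕ :=
  Module.finrank (IsLocalRing.ResidueField (X.presheaf.stalk x)) (ZariskiTangentSpace X x)

/-- The maximal dimension of a tangent space at a point of the variety. -/
noncomputable def maxTangentDim (X : Scheme.{u}) : ℕ :=
  ⨆ x : VarietyPoint X, tangentDim X x.1

/-! A finite group fixing a closed point $x$ acts on the local ring at $x$. The action is faithful
because $\operatorname{Spec}\mathcal O_x\to X$ is dominant and $X$ is reduced and separated. In
characteristic zero an element of finite order that acts trivially on $\mathfrak m/\mathfrak m^2$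
acts trivially on $\mathcal O_x$ (`cotangentAction_injective`), so the group embeds in
$\mathbf{GL}_m(k)$.

The maximum $m$ exists because the generators of an affine coordinate ring, shifted by constants,
generate every maximal ideal; their number bounds the tangent dimensions, and finitely many affine
opens suffice.

Jordan's theorem makes the constant of $\mathbf{GL}_m(k)$ a genuine bound. A finite linear group is
defined over a countable field, hence over $\mathbb C$, and preserves a norm on the underlying real
space. Its elements at distance less than $1/2$ from $1$ commute with each other, and a packing
bound controls the index of the subgroup they generate. -/

open scoped commutatorElement

/-! ### Finite groups of contractions in a normed algebra -/

section NormedAlgebra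

variable {A G : Type*} [NormedRing A] [Group G] {ρ : G →* A}

theorem norm_mul_map_le (hρ : ∀ g, ‖ρ g‖ ≤ 1) (g : G) (a : A) : ‖ρ g * a‖ ≤ ‖a‖ :=
  (norm_mul_le _ _).trans (mul_le_of_le_one_left (norm_nonneg _) (hρ g))

theorem norm_map_mul_le (hρ : ∀ g, ‖ρ g‖ ≤ 1) (g : G) (a : A) : ‖a * ρ g‖ ≤ ‖a‖ :=
  (norm_mul_le _ _).trans (mul_le_of_le_one_right (norm_nonneg _) (hρ g))

theorem norm_map_conj_sub_one_le (hρ : ∀ g, ‖ρ g‖ ≤ 1) (g h : G) :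
    ‖ρ (g * h * g⁻¹) - 1‖ ≤ ‖ρ h - 1‖ := by
  have e : ρ (g * h * g⁻¹) - 1 = ρ g * ((ρ h - 1) * ρ g⁻¹) := by
    have : ρ g * ρ g⁻¹ = 1 := by rw [← map_mul]; simp
    rw [sub_mul, mul_sub, one_mul, this, map_mul, map_mul, mul_assoc]
  rw [e]
  exact (norm_mul_map_le hρ _ _).trans (norm_map_mul_le hρ _ _)

theorem norm_map_commutator_sub_one_le (hρ : ∀ g, ‖ρ g‖ ≤ 1) (g h : G) :
    ‖ρ ⁅g, h⁆ - 1‖ ≤ 2 * ‖ρ g - 1‖ * ‖ρ h - 1‖ := by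
  have e : ρ ⁅g, h⁆ - 1 =
      ((ρ g - 1) * (ρ h - 1) - (ρ h - 1) * (ρ g - 1)) * ρ (g⁻¹ * h⁻¹) := by
    have h1 : (ρ g - 1) * (ρ h - 1) - (ρ h - 1) * (ρ g - 1) = ρ (g * h) - ρ (h * g) := by
      rw [map_mul, map_mul]; noncomm_ring
    rw [h1, sub_mul, ← map_mul, ← map_mul, commutatorElement_def, ← map_one ρ]
    congr 2 <;> group
  rw [e]
  refine (norm_map_mul_le hρ _ _).trans ((norm_sub_le _ _).trans ?_)
  have h1 := norm_mul_le (ρ g - 1) (ρ h - 1)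
  have h2 := norm_mul_le (ρ h - 1) (ρ g - 1)
  linarith

/-- The unit ball around `1` contains no nontrivial finite cyclic group. -/
theorem eq_one_of_forall_norm_pow_sub_one_lt [NormedAlgebra ℝ A] (hinj : Function.Injective ρ)
    {c : G} (hc : IsOfFinOrder c) (h : ∀ n : ℕ, ‖ρ (c ^ n) - 1‖ < 1) : c = 1 := by
  set N := orderOf c with hN
  have hN0 : 0 < N := hc.orderOf_pos
  apply hinj
  rw [map_one, ← sub_eq_zero]
  set x := ρ c - 1 with hx
  -- The geometric sum is annihilated by `x`. Subtracting `1` from each of its `N` terms gives a sum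
  -- of norm less than `N` that `x` multiplies to `-N x`, which forces `x = 0`.
  have hsum : x * ∑ i ∈ Finset.range N, ρ c ^ i = 0 := by
    rw [mul_geom_sum, ← map_pow, pow_orderOf_eq_one, map_one, sub_self]
  have hsum' : x * ∑ i ∈ Finset.range N, (ρ (c ^ i) - 1) = -((N : ℝ) • x) := by
    have : ∑ i ∈ Finset.range N, (ρ (c ^ i) - 1) = ∑ i ∈ Finset.range N, ρ c ^ i - (N : A) := by
      simp [Finset.sum_sub_distrib]
    rw [this, mul_sub, hsum, zero_sub, Nat.cast_smul_eq_nsmul, nsmul_eq_mul,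
      (Nat.cast_commute N x).eq]
  have hlt : ‖∑ i ∈ Finset.range N, (ρ (c ^ i) - 1)‖ < N := by
    calc _ ≤ ∑ i ∈ Finset.range N, ‖ρ (c ^ i) - 1‖ := norm_sum_le _ _
      _ < ∑ i ∈ Finset.range N, (1 : ℝ) :=
        Finset.sum_lt_sum_of_nonempty (Finset.nonempty_range_iff.2 hN0.ne') fun i _ => h i
      _ = N := by simp
  by_contra hne
  have hpos : 0 < ‖x‖ := norm_pos_iff.2 hne
  have h1 : (N : ℝ) * ‖x‖ ≤ ‖x‖ * ‖∑ i ∈ Finset.range N, (ρ (c ^ i) - 1)‖ := by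
    have := norm_mul_le x (∑ i ∈ Finset.range N, (ρ (c ^ i) - 1))
    rwa [hsum', norm_neg, norm_smul, Real.norm_natCast] at this
  nlinarith

/-- Since $c=[g,h]$ commutes with $g$, conjugating $h$ by $g^n$ gives $c^nh$. Hence every power of
$c$ stays within $2\|\rho(h)-1\|<1$ of the identity. -/
theorem commutator_eq_one_of_commute [NormedAlgebra ℝ A] [Finite G] (hinj : Function.Injective ρ)
    (hρ : ∀ g, ‖ρ g‖ ≤ 1) {g h : G} (hh : ‖ρ h - 1‖ < 1 / 2) (hcomm : Commute g ⁅g, h⁆) :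
    ⁅g, h⁆ = 1 := by
  set c := ⁅g, h⁆ with hc
  have hconj : ∀ n : ℕ, g ^ n * h * (g ^ n)⁻¹ = c ^ n * h := by
    intro n
    induction n with
    | zero => simp
    | succ n ih =>
      have h1 : g * h * g⁻¹ = c * h := by rw [hc, commutatorElement_def]; group
      calc g ^ (n + 1) * h * (g ^ (n + 1))⁻¹ = g * (g ^ n * h * (g ^ n)⁻¹) * g⁻¹ := by
            rw [pow_succ']; group
        _ = (g * c ^ n) * h * g⁻¹ := by rw [ih]; group
        _ = c ^ n * (g * h * g⁻¹) := by rw [(hcomm.pow_right n).eq]; group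
        _ = c ^ (n + 1) * h := by rw [h1, pow_succ]; group
  refine eq_one_of_forall_norm_pow_sub_one_lt hinj (isOfFinOrder_of_finite c) fun n => ?_
  have h1 : ‖ρ (c ^ n * h) - 1‖ ≤ ‖ρ h - 1‖ := by
    rw [← hconj]; exact norm_map_conj_sub_one_le hρ _ _
  have h2 : ‖ρ (c ^ n) * (ρ h - 1)‖ ≤ ‖ρ h - 1‖ := norm_mul_map_le hρ _ _
  have e : ρ (c ^ n) - 1 = (ρ (c ^ n * h) - 1) - ρ (c ^ n) * (ρ h - 1) := by
    rw [mul_sub, mul_one, map_mul]; abel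
  rw [e]
  exact (norm_sub_le _ _).trans_lt (by linarith)

theorem commute_of_norm_map_sub_one_lt [NormedAlgebra ℝ A] [Finite G]
    (hinj : Function.Injective ρ) (hρ : ∀ g, ‖ρ g‖ ≤ 1) {g : G} (hg : ‖ρ g - 1‖ < 1 / 2) (h : G)
    (hh : ‖ρ h - 1‖ < 1 / 2) : Commute g h := by
  have wf : WellFounded fun a b : G => ‖ρ a - 1‖ < ‖ρ b - 1‖ :=
    @Finite.wellFounded_of_trans_of_irrefl G _ _ ⟨fun _ _ _ => lt_trans⟩ ⟨fun _ => lt_irrefl _⟩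
  induction h using wf.induction with
  | _ h ih =>
    by_cases h1 : h = 1
    · rw [h1]; exact Commute.one_right g
    have hpos : 0 < ‖ρ h - 1‖ := by
      rw [norm_pos_iff, sub_ne_zero, ← map_one ρ]
      exact fun e => h1 (hinj e)
    -- The commutator is strictly closer to `1` than `h`, so by induction it commutes with `g`.
    have hlt : ‖ρ ⁅g, h⁆ - 1‖ < ‖ρ h - 1‖ :=
      (norm_map_commutator_sub_one_le hρ g h).trans_lt (by nlinarith)
    exact commutatorElement_eq_one_iff_commute.1
      (commutator_eq_one_of_commute hinj hρ hh (ih _ hlt (hlt.trans hh)))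

theorem exists_normal_abelian_index_le_of_norm_map_le_one [NormedAlgebra ℝ A]
    [FiniteDimensional ℝ A] [Finite G] (hinj : Function.Injective ρ) (hρ : ∀ g, ‖ρ g‖ ≤ 1) :
    ∃ H : Subgroup G, H.Normal ∧ IsMulCommutative H ∧ H.index ≤ 5 ^ Module.finrank ℝ A := by
  set S : Set G := {g | ‖ρ g - 1‖ < 1 / 2} with hS
  refine ⟨Subgroup.closure S, ?_, ?_, ?_⟩
  · have hconj : Group.conjugatesOfSet S ⊆ S := by
      intro x hx
      obtain ⟨a, ha, hax⟩ := Group.mem_conjugatesOfSet_iff.1 hx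
      obtain ⟨c, rfl⟩ := isConj_iff.1 hax
      exact (norm_map_conj_sub_one_le hρ c a).trans_lt ha
    rw [← hconj.antisymm Group.subset_conjugatesOfSet]
    exact Subgroup.normalClosure_normal
  · exact Subgroup.isMulCommutative_closure fun x hx y hy =>
      (commute_of_norm_map_sub_one_lt hinj hρ hx y hy).eq
  · classical
    have := Fintype.ofFinite (G ⧸ Subgroup.closure S)
    -- Representatives of distinct cosets are at distance at least 1/2. Doubling makes them
    -- 1-separated in the ball of radius 2, where Besicovitch's packing bound is `5 ^ dim`.
    set f : G ⧸ Subgroup.closure S → A := fun q => (2 : ℝ) • ρ q.out with hf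
    have hsep : ∀ a b, a ≠ b → 1 ≤ ‖f a - f b‖ := by
      intro a b hab
      by_contra! hlt
      refine hab ?_
      rw [← Quotient.out_eq' a, ← Quotient.out_eq' b]
      refine Quotient.sound' (QuotientGroup.leftRel_apply.2 (Subgroup.subset_closure ?_))
      change ‖ρ (a.out⁻¹ * b.out) - 1‖ < 1 / 2
      rw [norm_sub_rev]
      have e : 1 - ρ (a.out⁻¹ * b.out) = ρ a.out⁻¹ * (ρ a.out - ρ b.out) := by
        rw [mul_sub, ← map_mul, ← map_mul, inv_mul_cancel, map_one]
      rw [hf, ← smul_sub, norm_smul, Real.norm_ofNat] at hlt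
      rw [e]
      exact (norm_mul_map_le hρ _ _).trans_lt (by linarith)
    have hfinj : Function.Injective f := by
      intro a b hab
      by_contra hne
      have := hsep a b hne
      rw [hab, sub_self, norm_zero] at this
      linarith
    have := Besicovitch.card_le_of_separated (Finset.univ.image f) ?_ ?_
    · rwa [Finset.card_image_of_injective _ hfinj, Finset.card_univ, ← Nat.card_eq_fintype_card]
        at this
    · intro c hc
      obtain ⟨q, -, rfl⟩ := Finset.mem_image.1 hc
      rw [hf, norm_smul, Real.norm_ofNat]
      linarith [hρ q.out]
    · intro c hc d hd hcd
      obtain ⟨q, -, rfl⟩ := Finset.mem_image.1 hc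
      obtain ⟨r, -, rfl⟩ := Finset.mem_image.1 hd
      exact hsep q r fun h => hcd (h ▸ rfl)

end NormedAlgebra

/-- The norm of `v` is taken to be the largest sup norm along its orbit. The group only permutes the
orbit, so it acts by contractions. -/
theorem exists_normal_abelian_index_le_of_injective_real {V G : Type*} [AddCommGroup V]
    [Module ℝ V] [FiniteDimensional ℝ V] [Group G] [Finite G] (ρ : G →* Module.End ℝ V)
    (hinj : Function.Injective ρ) :
    ∃ H : Subgroup G, H.Normal ∧ IsMulCommutative H ∧
      H.index ≤ 5 ^ (Module.finrank ℝ V * Module.finrank ℝ V) := by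
  have := Fintype.ofFinite G
  let e := (Module.finBasis ℝ V).equivFun
  let f : V →ₗ[ℝ] (G → Fin (Module.finrank ℝ V) → ℝ) :=
    LinearMap.pi fun g => e.toLinearMap ∘ₗ ρ g
  have hf : Function.Injective f := by
    intro v w h
    have := congrFun h 1
    simpa [f] using this
  let : NormedAddCommGroup V := NormedAddCommGroup.induced V _ f hf
  let : NormedSpace ℝ V := NormedSpace.induced ℝ V _ f
  let E : Module.End ℝ V ≃ₐ[ℝ] (V →L[ℝ] V) := Module.End.toContinuousLinearMap V
  let σ : G →* (V →L[ℝ] V) := (E : Module.End ℝ V →* (V →L[ℝ] V)).comp ρ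
  have hσ : ∀ g, ‖σ g‖ ≤ 1 := by
    intro g
    refine ContinuousLinearMap.opNorm_le_bound _ zero_le_one fun v => ?_
    rw [one_mul]
    change ‖f (ρ g v)‖ ≤ ‖f v‖
    refine (pi_norm_le_iff_of_nonneg (norm_nonneg _)).2 fun h => ?_
    have : f (ρ g v) h = f v (h * g) := by simp [f]
    rw [this]
    exact norm_le_pi_norm (f v) (h * g)
  have hσinj : Function.Injective σ := E.injective.comp hinj
  have := exists_normal_abelian_index_le_of_norm_map_le_one hσinj hσ
  rwa [← E.toLinearEquiv.finrank_eq, Module.finrank_linearMap] at this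

theorem JordanBound.exists_of_injective {G H : Type*} [Group G] [Group H] [Finite G] {d : ℕ}
    (hH : JordanBound H d) (f : G →* H) (hf : Function.Injective f) :
    ∃ A : Subgroup G, A.Normal ∧ IsMulCommutative A ∧ A.index ≤ d := by
  obtain ⟨A, hA, hcomm, hindex⟩ := hH f.range (Finite.of_surjective _ f.rangeRestrict_surjective)
  let e : G ≃* f.range := MonoidHom.ofInjective hf
  refine ⟨A.comap (e : G →* f.range), hA.comap _, ⟨⟨fun x y => ?_⟩⟩, ?_⟩
  · have := hcomm.is_comm.comm (⟨e x, x.2⟩ : A) ⟨e y, y.2⟩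
    exact Subtype.ext (e.injective (by simpa using congrArg Subtype.val this))
  · exact (Subgroup.index_comap_of_surjective A (f := (e : G →* f.range)) e.surjective).trans_le
      hindex

/-! ### Embedding countable fields in the complex numbers -/

section Embedding

open Cardinal

/-- A countable field of characteristic zero embeds in the complex numbers. -/
theorem nonempty_ringHom_complex_of_type_zero (K : Type) [Field K] [CharZero K] [Countable K] :
    Nonempty (K →+* ℂ) := by
  -- Adjoining continuum many variables makes the algebraic closure have cardinality exactly
  -- $\mathfrak c$, so Steinitz's theorem identifies it with $\mathbb C$.
  let P := MvPolynomial ℂ K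
  let L := AlgebraicClosure (FractionRing P)
  have hP : #P = 𝔠 := by
    rw [MvPolynomial.cardinalMk_eq_max, Cardinal.mk_complex]
    have : #K ≤ ℵ₀ := Cardinal.mk_le_aleph0
    simp [aleph0_le_continuum]
  have hL : #L = 𝔠 := by
    apply le_antisymm
    · have := Algebra.IsAlgebraic.cardinalMk_le_max (FractionRing P) L
      rwa [mk_fractionRing, hP, max_eq_left aleph0_le_continuum] at this
    · rw [← hP, ← mk_fractionRing]
      exact Cardinal.mk_le_of_injective (algebraMap (FractionRing P) L).injective
  have : CharZero (FractionRing P) := charZero_of_injective_algebraMap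
    (IsFractionRing.injective P (FractionRing P))
  have : CharZero L := charZero_of_injective_algebraMap (algebraMap (FractionRing P) L).injective
  obtain ⟨e⟩ := IsAlgClosed.ringEquiv_of_equiv_of_charZero (K := L) (L := ℂ)
    (hL ▸ aleph0_lt_continuum) (Cardinal.eq.1 (hL.trans Cardinal.mk_complex.symm))
  exact ⟨(e : L →+* ℂ).comp ((algebraMap (FractionRing P) L).comp
    ((algebraMap P (FractionRing P)).comp MvPolynomial.C))⟩

theorem nonempty_ringHom_complex_of_countable (K : Type*) [Field K] [CharZero K] [Countable K] :
    Nonempty (K →+* ℂ) := by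
  obtain ⟨K', ⟨e⟩⟩ : ∃ K' : Type, Nonempty (K' ≃ K) :=
    ⟨Shrink.{0} K, ⟨(equivShrink.{0} K).symm⟩⟩
  let _ : Field K' := e.field
  let f : K' ≃+* K := e.ringEquiv
  have : CharZero K' := charZero_of_injective_ringHom (f := (f.symm : K →+* K')) f.symm.injective
  have : Countable K' := e.injective.countable
  obtain ⟨φ⟩ := nonempty_ringHom_complex_of_type_zero K'
  exact ⟨φ.comp (f.symm : K →+* K')⟩

end Embedding

/-! ### Jordan's theorem in characteristic zero -/

theorem exists_normal_abelian_index_le_of_injective_complex {G : Type*} [Group G] [Finite G]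
    {n : ℕ} (ρ : G →* Matrix (Fin n) (Fin n) ℂ) (hρ : Function.Injective ρ) :
    ∃ H : Subgroup G, H.Normal ∧ IsMulCommutative H ∧ H.index ≤ 5 ^ ((2 * n) * (2 * n)) := by
  let τ : Matrix (Fin n) (Fin n) ℂ →* Module.End ℝ (Fin n → ℂ) :=
    { toFun := fun M => (Matrix.toLin' M).restrictScalars ℝ
      map_one' := by rw [Matrix.toLin'_one]; rfl
      map_mul' := fun M N => by rw [Matrix.toLin'_mul]; rfl }
  have hτ : Function.Injective τ := fun M N h =>
    Matrix.toLin'.injective (LinearMap.restrictScalars_injective ℝ h)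
  have hfr : Module.finrank ℝ (Fin n → ℂ) = 2 * n := by
    rw [Module.finrank_pi_fintype]; simp [mul_comm]
  have := exists_normal_abelian_index_le_of_injective_real (τ.comp ρ) (hτ.comp hρ)
  rwa [hfr] at this

/-- Jordan's theorem on finite linear groups. -/
theorem jordanBound_generalLinearGroup (k : Type*) [Field k] [CharZero k] (n : ℕ) :
    JordanBound (GL (Fin n) k) (5 ^ ((2 * n) * (2 * n))) := by
  intro G hG
  -- The finitely many matrix entries generate a countable subfield, over which the group is already
  -- defined.
  let S : Set k := Set.range fun p : G × Fin n × Fin n => (p.1 : GL (Fin n) k).1 p.2.1 p.2.2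
  let K := Subfield.closure S
  have hS : S.Finite := Set.finite_range _
  have : Countable K := by
    rw [← Cardinal.mk_le_aleph0_iff]
    exact (Subfield.cardinalMk_closure_le_max S).trans
      (max_le (Cardinal.mk_le_aleph0_iff.2 hS.countable.to_subtype) le_rfl)
  have : CharZero K := inferInstance
  obtain ⟨φ⟩ := nonempty_ringHom_complex_of_countable K
  let ι : Matrix (Fin n) (Fin n) K →* Matrix (Fin n) (Fin n) k :=
    (K.subtype.mapMatrix : Matrix (Fin n) (Fin n) K →+* Matrix (Fin n) (Fin n) k)
  have hι : Function.Injective ι := Matrix.map_injective K.subtype.injective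
  let ρ : G →* Matrix (Fin n) (Fin n) k := (Units.coeHom _).comp G.subtype
  have hρ : Function.Injective ρ := fun a b h => Subtype.ext (Units.ext h)
  have hmem : ∀ g, ρ g ∈ MonoidHom.mrange ι := fun g =>
    ⟨Matrix.of fun i j => ⟨ρ g i j, Subfield.subset_closure ⟨(g, i, j), rfl⟩⟩, by
      ext i j; rfl⟩
  let e : Matrix (Fin n) (Fin n) K ≃* MonoidHom.mrange ι := MulEquiv.ofBijective ι.mrangeRestrict
    ⟨fun a b h => hι (congrArg Subtype.val h), ι.mrangeRestrict_surjective⟩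
  let σ : G →* Matrix (Fin n) (Fin n) K := (e.symm : _ →* _).comp (ρ.codRestrict _ hmem)
  have hσ : Function.Injective σ :=
    e.symm.injective.comp fun a b h => hρ (congrArg Subtype.val h)
  let θ : Matrix (Fin n) (Fin n) K →* Matrix (Fin n) (Fin n) ℂ :=
    (φ.mapMatrix : Matrix (Fin n) (Fin n) K →+* Matrix (Fin n) (Fin n) ℂ)
  have hθ : Function.Injective θ := Matrix.map_injective φ.injective
  exact exists_normal_abelian_index_le_of_injective_complex (θ.comp σ) (hθ.comp hσ)

/-! ### Faithfulness on the cotangent space -/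

section CotangentAction

open IsLocalRing

/-- An endomorphism of finite order which is the identity modulo the square of the maximal ideal
is the identity. -/
theorem RingHom.eq_id_of_pow_eq_id_of_sub_mem_sq {R : Type*} [CommRing R] [IsLocalRing R]
    [IsNoetherianRing R] [Algebra ℚ R] (σ : R →+* R) {N : ℕ} (hN : N ≠ 0)
    (hσN : ∀ a, σ^[N] a = a) (hσ : ∀ a, σ a - a ∈ maximalIdeal R ^ 2) (a : R) : σ a = a := by
  set m := maximalIdeal R
  have hsub : ∀ j, ∀ a ∈ m ^ j, σ a - a ∈ m ^ (j + 1) := by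
    intro j
    induction j with
    | zero => exact fun a _ => Ideal.pow_le_pow_right (by norm_num) (hσ a)
    | succ j ih =>
      intro a ha
      rw [pow_succ] at ha
      refine Submodule.mul_induction_on ha (fun x hx y hy => ?_) (fun x y hx hy => ?_)
      · have hy' : σ y ∈ m := by
          have := add_mem (Ideal.pow_le_self two_ne_zero (hσ y)) hy
          simpa using this
        have e : σ (x * y) - x * y = (σ x - x) * σ y + x * (σ y - y) := by
          rw [map_mul]; ring
        rw [e]
        refine add_mem ?_ ?_
        · rw [pow_succ]; exact Ideal.mul_mem_mul (ih x hx) hy'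
        · rw [add_assoc, pow_add]; exact Ideal.mul_mem_mul hx (hσ y)
      · have e : σ (x + y) - (x + y) = (σ x - x) + (σ y - y) := by rw [map_add]; ring
        rw [e]; exact add_mem hx hy
  have hunit : IsUnit (N : R) := by
    have := (isUnit_iff_ne_zero.2 (Nat.cast_ne_zero.2 hN : (N : ℚ) ≠ 0)).map (algebraMap ℚ R)
    simpa using this
  have hall : ∀ j, ∀ a, σ a - a ∈ m ^ j := by
    intro j
    induction j with
    | zero => simp
    | succ j ih =>
      intro a
      have hiter : ∀ n : ℕ, σ^[n] a - a - (n : R) * (σ a - a) ∈ m ^ (j + 1) := by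
        intro n
        induction n with
        | zero => simp
        | succ n ihn =>
          have h1 : σ (σ^[n] a - a) - (σ^[n] a - a) ∈ m ^ (j + 1) := by
            refine hsub j _ ?_
            clear ihn
            induction n with
            | zero => simp
            | succ n ihn =>
              rw [Function.iterate_succ_apply']
              simpa using add_mem (ih (σ^[n] a)) ihn
          have e : σ^[n + 1] a - a - ((n + 1 : ℕ) : R) * (σ a - a) =
              (σ (σ^[n] a - a) - (σ^[n] a - a)) + (σ^[n] a - a - (n : R) * (σ a - a)) := by
            rw [Function.iterate_succ_apply', map_sub]; push_cast; ring
          rw [e]; exact add_mem h1 ihn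
      have := hiter N
      rw [hσN, sub_self, zero_sub, neg_mem_iff] at this
      exact (Ideal.unit_mul_mem_iff_mem _ hunit).1 this
  have : σ a - a ∈ (⨅ j : ℕ, m ^ j) := (Submodule.mem_iInf _).2 fun j => hall j a
  rw [Ideal.iInf_pow_eq_bot_of_isLocalRing _ (Ideal.IsPrime.ne_top inferInstance)] at this
  exact sub_eq_zero.1 this

variable {k R G : Type*} [Field k] [CommRing R] [IsLocalRing R] [Algebra k R] [Group G]

theorem maximalIdeal_le_comap_of_monoidHom (τ : G →* (R →ₐ[k] R)) (g : G) :
    maximalIdeal R ≤ (maximalIdeal R).comap (τ g) := by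
  intro a ha
  rw [Ideal.mem_comap, mem_maximalIdeal, mem_nonunits_iff]
  intro h
  refine (mem_maximalIdeal _).1 ha ?_
  have := h.map (τ g⁻¹)
  rwa [← AlgHom.mul_apply, ← map_mul, inv_mul_cancel, map_one, AlgHom.one_apply] at this

/-- The linear action on the cotangent space induced by an action on a local algebra. -/
def cotangentAction (τ : G →* (R →ₐ[k] R)) : G →* Module.End k (CotangentSpace R) where
  toFun g := Ideal.mapCotangent _ _ (τ g) (maximalIdeal_le_comap_of_monoidHom τ g)
  map_one' := by
    ext x
    obtain ⟨x, rfl⟩ := Ideal.toCotangent_surjective _ x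
    simp
  map_mul' g h := by
    ext x
    obtain ⟨x, rfl⟩ := Ideal.toCotangent_surjective _ x
    simp

theorem cotangentAction_injective [IsNoetherianRing R] [CharZero k] [Finite G]
    (hk : Function.Surjective (algebraMap k (ResidueField R))) (τ : G →* (R →ₐ[k] R))
    (hτ : Function.Injective τ) : Function.Injective (cotangentAction τ) := by
  rw [injective_iff_map_eq_one]
  intro g hg
  let _ : Algebra ℚ R := ((algebraMap k R).comp (algebraMap ℚ k)).toAlgebra
  rw [← map_eq_one_iff τ hτ]
  have hm : ∀ x ∈ maximalIdeal R, τ g x - x ∈ maximalIdeal R ^ 2 := by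
    intro x hx
    have := LinearMap.congr_fun hg ((maximalIdeal R).toCotangent ⟨x, hx⟩)
    exact (Ideal.toCotangent_eq _).1 this
  ext a
  refine RingHom.eq_id_of_pow_eq_id_of_sub_mem_sq (τ g : R →+* R)
    (orderOf_pos g).ne' (fun b => ?_) (fun b => ?_) a
  · have : ∀ n : ℕ, ((τ g : R →+* R) : R → R)^[n] b = τ (g ^ n) b := by
      intro n
      induction n with
      | zero => simp
      | succ n ih => rw [Function.iterate_succ_apply', ih, pow_succ', map_mul]; rfl
    rw [this, pow_orderOf_eq_one, map_one]; rfl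
  -- Constants are fixed and `R` is `k` plus the maximal ideal, so congruence on the maximal ideal
  -- extends to all of `R`.
  · obtain ⟨c, hc⟩ := hk (residue R b)
    have hb : b - algebraMap k R c ∈ maximalIdeal R := by
      rw [← residue_eq_zero_iff, map_sub, ← hc, sub_eq_zero]
      rfl
    simpa using hm _ hb

theorem exists_injective_generalLinearGroup_of_end {M : Type*} [AddCommGroup M] [Module k M]
    [FiniteDimensional k M] (f : G →* Module.End k M) (hf : Function.Injective f) {n : ℕ}
    (hn : Module.finrank k M ≤ n) : ∃ F : G →* GL (Fin n) k, Function.Injective F := by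
  -- A trivial summand fills the dimension up to `n`.
  let V := M × (Fin (n - Module.finrank k M) → k)
  let p : Module.End k M →* Module.End k V :=
    { toFun := fun u => u.prodMap LinearMap.id
      map_one' := rfl
      map_mul' := fun _ _ => rfl }
  have hp : Function.Injective p := fun u v h => by
    ext x
    exact congrArg Prod.fst (LinearMap.congr_fun h (x, 0))
  have hV : Module.finrank k V = n := by simp [V, hn]
  let e := LinearMap.toMatrixAlgEquiv (Module.finBasisOfFinrankEq k V hV)
  let F : G →* Matrix (Fin n) (Fin n) k := ((e : _ →* Matrix (Fin n) (Fin n) k).comp p).comp f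
  have hF : Function.Injective F := (e.injective.comp hp).comp hf
  exact ⟨F.toHomUnits, fun a b h => hF (congrArg Units.val h)⟩

theorem finrank_cotangentSpace_eq_of_bijective
    (hk : Function.Bijective (algebraMap k (ResidueField R))) :
    Module.finrank k (CotangentSpace R) = Module.finrank (ResidueField R) (CotangentSpace R) := by
  have h1 : Module.finrank k (ResidueField R) = 1 := by
    have := (LinearEquiv.ofBijective (Algebra.linearMap k (ResidueField R)) hk).finrank_eq
    simpa using this.symm
  have : IsScalarTower k (ResidueField R) (CotangentSpace R) :=
    IsScalarTower.of_algebraMap_smul fun c x => by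
      rw [IsScalarTower.algebraMap_apply k R (ResidueField R), IsScalarTower.algebraMap_smul,
        IsScalarTower.algebraMap_smul]
  rw [← Module.finrank_mul_finrank k (ResidueField R) (CotangentSpace R), h1, one_mul]

theorem finiteDimensional_cotangentSpace_of_surjective [IsNoetherianRing R]
    (hk : Function.Surjective (algebraMap k (ResidueField R))) :
    FiniteDimensional k (CotangentSpace R) := by
  have : Module.Finite k (ResidueField R) :=
    Module.Finite.of_surjective (Algebra.linearMap k (ResidueField R)) hk
  have : IsScalarTower k (ResidueField R) (CotangentSpace R) :=
    IsScalarTower.of_algebraMap_smul fun c x => by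
      rw [IsScalarTower.algebraMap_apply k R (ResidueField R), IsScalarTower.algebraMap_smul,
        IsScalarTower.algebraMap_smul]
  exact Module.Finite.trans (ResidueField R) _

end CotangentAction

/-! ### Action on the local ring at a fixed point -/

section Stalk

variable {k : Type u} [Field k] {X : Scheme.{u}}

theorem exists_stalk_endomorphism {f : X ⟶ X} {x : X} (hx : f x = x) :
    ∃ φ : X.presheaf.stalk x ⟶ X.presheaf.stalk x,
      Spec.map φ ≫ X.fromSpecStalk x = X.fromSpecStalk x ≫ f := by
  have hs : f x ⤳ x := specializes_of_eq hx
  refine ⟨X.presheaf.stalkSpecializes hs ≫ f.stalkMap x, ?_⟩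
  rw [Spec.map_comp, Category.assoc, Scheme.SpecMap_stalkSpecializes_fromSpecStalk,
    Scheme.SpecMap_stalkMap_fromSpecStalk]

/-- The image consists of the generizations of `x`, among them the generic point. -/
instance isDominant_fromSpecStalk [IrreducibleSpace X] (x : X) :
    IsDominant (X.fromSpecStalk x) := by
  refine ⟨?_⟩
  rw [DenseRange, Scheme.range_fromSpecStalk]
  have h : genericPoint X ∈ {y : X | y ⤳ x} := genericPoint_specializes x
  rw [dense_iff_closure_eq, ← Set.univ_subset_iff, ← genericPoint_closure]
  exact closure_mono (Set.singleton_subset_iff.2 h)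

/-- The structure of a `k`-algebra on the local ring of a scheme over `k`. -/
noncomputable abbrev stalkAlgebra (π : X ⟶ Spec (.of k)) (x : X) :
    Algebra k (X.presheaf.stalk x) :=
  (Spec.preimage (X.fromSpecStalk x ≫ π)).hom.toAlgebra

theorem bijective_algebraMap_residueField [IsAlgClosed k] (π : X ⟶ Spec (.of k))
    [LocallyOfFiniteType π] {x : X} (hx : IsClosed {x}) :
    letI := stalkAlgebra π x
    Function.Bijective (algebraMap k (IsLocalRing.ResidueField (X.presheaf.stalk x))) := by
  have h : Spec.preimage (X.fromSpecStalk x ≫ π) ≫ X.residue x =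
      (residueFieldIsoBase π x hx).inv := by
    apply Spec.map_injective
    rw [SpecMap_residueFieldIsoBase_inv, Spec.map_comp, Spec.map_preimage, ← Category.assoc]
    rfl
  have h' := (ConcreteCategory.isIso_iff_bijective
    (residueFieldIsoBase π x hx).inv).1 inferInstance
  rw [← h] at h'
  exact h'

theorem exists_stalk_action (π : X ⟶ Spec (.of k)) [IsReduced X] [IrreducibleSpace X]
    [IsSeparated π] (G : Subgroup (VarietyAut π)) {x : X}
    (hx : ∀ g ∈ G, VarietyAut.act g x = x) :
    letI := stalkAlgebra π x
    ∃ τ : G →* (X.presheaf.stalk x →ₐ[k] X.presheaf.stalk x), Function.Injective τ := by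
  let _ := stalkAlgebra π x
  let a : G → (X ⟶ X) := fun g => g.1.hom.left
  have hex : ∀ g : G, ∃ φ : X.presheaf.stalk x ⟶ X.presheaf.stalk x,
      Spec.map φ ≫ X.fromSpecStalk x = X.fromSpecStalk x ≫ a g :=
    fun g => exists_stalk_endomorphism (hx g.1 g.2)
  choose φ hφ using hex
  have hφ_ext : ∀ (a b : X.presheaf.stalk x ⟶ X.presheaf.stalk x),
      Spec.map a ≫ X.fromSpecStalk x = Spec.map b ≫ X.fromSpecStalk x → a = b :=
    fun a b h => Spec.map_injective ((cancel_mono _).1 h)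
  have hφ_one : φ 1 = 𝟙 _ := by
    apply hφ_ext
    rw [hφ, Spec.map_id, Category.id_comp]
    exact Category.comp_id _
  have hφ_mul : ∀ g h, φ (g * h) = φ g ≫ φ h := by
    intro g h
    apply hφ_ext
    rw [hφ, Spec.map_comp, Category.assoc, hφ, ← Category.assoc, hφ, Category.assoc]
    rfl
  have hw : ∀ g : G, a g ≫ π = π := fun g => Over.w g.1.hom
  have hφ_alg : ∀ g, Spec.preimage (X.fromSpecStalk x ≫ π) ≫ φ g =
      Spec.preimage (X.fromSpecStalk x ≫ π) := by
    intro g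
    apply Spec.map_injective
    rw [Spec.map_comp, Spec.map_preimage, ← Category.assoc, hφ, Category.assoc, hw]
  let ψ : G → (X.presheaf.stalk x →ₐ[k] X.presheaf.stalk x) := fun g =>
    { (φ g).hom with
      commutes' := fun c => ConcreteCategory.congr_hom (hφ_alg g) c }
  have hψ_inj : Function.Injective ψ := by
    intro g h hgh
    have hgh' : φ g = φ h := by
      ext a
      exact DFunLike.congr_fun hgh a
    refine Subtype.ext (Iso.ext (Over.OverMorphism.ext ?_))
    change a g = a h
    -- Morphisms from a reduced scheme that agree after a dominant map are equal when the target is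
    -- separated.
    refine ext_of_isDominant_of_isSeparated π ((hw _).trans (hw _).symm) (X.fromSpecStalk x) ?_
    rw [← hφ g, ← hφ h, hgh']
  -- Pullback of functions reverses composition; the inverse restores a left action.
  refine ⟨{ toFun := fun g => ψ g⁻¹, map_one' := ?_, map_mul' := fun g h => ?_ },
    hψ_inj.comp inv_injective⟩
  · ext a
    change (φ 1⁻¹).hom a = a
    rw [inv_one, hφ_one]
    rfl
  · ext a
    change (φ (g * h)⁻¹).hom a = (φ g⁻¹).hom ((φ h⁻¹).hom a)
    rw [mul_inv_rev, hφ_mul]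
    rfl

theorem exists_injective_generalLinearGroup_of_fixed [IsAlgClosed k] [CharZero k]
    {π : X ⟶ Spec (.of k)} (hX : IsAlgebraicVariety π) [IrreducibleSpace X]
    (G : Subgroup (VarietyAut π)) [Finite G] {x : X} (hxc : IsClosed {x})
    (hx : ∀ g ∈ G, VarietyAut.act g x = x) {n : ℕ} (hn : tangentDim X x ≤ n) :
    ∃ F : G →* GL (Fin n) k, Function.Injective F := by
  have := hX.isReduced
  have := hX.isSeparated
  have := hX.locallyOfFiniteType
  have : IsLocallyNoetherian X := LocallyOfFiniteType.isLocallyNoetherian π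
  let _ := stalkAlgebra π x
  have hk := bijective_algebraMap_residueField π hxc
  obtain ⟨τ, hτ⟩ := exists_stalk_action π G hx
  have := finiteDimensional_cotangentSpace_of_surjective hk.surjective
  refine exists_injective_generalLinearGroup_of_end (cotangentAction τ)
    (cotangentAction_injective hk.surjective τ hτ) ?_
  rwa [finrank_cotangentSpace_eq_of_bijective hk, ← Subspace.dual_finrank_eq]

end Stalk

/-! ### Boundedness of tangent dimensions -/

section TangentDimension

theorem IsLocalRing.spanFinrank_maximalIdeal_le_card {k A R : Type*} [Field k] [CommRing A]
    [CommRing R] [IsLocalRing R] [Algebra k A] [Algebra A R] (p : Ideal A) [p.IsPrime]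
    [IsLocalization.AtPrime R p] (s : Finset A) (hs : Algebra.adjoin k (s : Set A) = ⊤)
    (hk : Function.Surjective
      ((IsLocalRing.residue R).comp ((algebraMap A R).comp (algebraMap k A)))) :
    (IsLocalRing.maximalIdeal R).spanFinrank ≤ s.card := by
  choose c hc using fun a : A => hk (IsLocalRing.residue R (algebraMap A R a))
  let t : A → R := fun a => algebraMap A R (a - algebraMap k A (c a))
  have ht : ∀ a, t a ∈ IsLocalRing.maximalIdeal R := fun a => by
    rw [← IsLocalRing.residue_eq_zero_iff]
    simp only [t, map_sub, ← hc a]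
    exact sub_self _
  let J : Ideal R := Ideal.span (t '' s)
  have hJ : J ≤ IsLocalRing.maximalIdeal R := by
    refine Ideal.span_le.2 ?_
    rintro _ ⟨a, -, rfl⟩
    exact ht a
  -- Modulo `J` all of `A` reduces to constants. For an element of `p` the constant lies in the
  -- maximal ideal, hence is zero, so `J` is the whole maximal ideal.
  have hall : ∀ a : A, ∃ b : k, algebraMap A R (a - algebraMap k A b) ∈ J := by
    intro a
    have ha : a ∈ Algebra.adjoin k (s : Set A) := hs ▸ Algebra.mem_top
    induction ha using Algebra.adjoin_induction with
    | mem x hx => exact ⟨c x, Ideal.subset_span ⟨x, hx, rfl⟩⟩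
    | algebraMap r => exact ⟨r, by simp⟩
    | add x y _ _ hx hy =>
      obtain ⟨b, hb⟩ := hx
      obtain ⟨d, hd⟩ := hy
      refine ⟨b + d, ?_⟩
      convert! add_mem hb hd using 1
      rw [← map_add, map_add]
      congr 1
      ring
    | mul x y _ _ hx hy =>
      obtain ⟨b, hb⟩ := hx
      obtain ⟨d, hd⟩ := hy
      refine ⟨b * d, ?_⟩
      convert! add_mem (J.mul_mem_left (algebraMap A R x) hd)
        (J.mul_mem_left (algebraMap A R (algebraMap k A d)) hb) using 1
      rw [← map_mul, ← map_mul, ← map_add, map_mul]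
      congr 1
      ring
  have hmJ : IsLocalRing.maximalIdeal R ≤ J := by
    rw [← IsLocalization.AtPrime.map_eq_maximalIdeal p R, Ideal.map_le_iff_le_comap]
    intro a ha
    rw [Ideal.mem_comap]
    obtain ⟨b, hb⟩ := hall a
    have ha' : algebraMap A R a ∈ IsLocalRing.maximalIdeal R := by
      rw [← IsLocalization.AtPrime.map_eq_maximalIdeal p R]
      exact Ideal.mem_map_of_mem _ ha
    have hb' : algebraMap A R (algebraMap k A b) ∈ IsLocalRing.maximalIdeal R := by
      have := sub_mem ha' (hJ hb)
      rwa [map_sub, sub_sub_cancel] at this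
    have hb0 : b = 0 := by
      by_contra hne
      exact (IsLocalRing.mem_maximalIdeal _).1 hb'
        (((isUnit_iff_ne_zero.2 hne).map (algebraMap k A)).map (algebraMap A R))
    simpa [hb0] using hb
  rw [hmJ.antisymm hJ]
  classical
  calc J.spanFinrank ≤ (t '' s).ncard :=
        Submodule.spanFinrank_span_le_ncard_of_finite (s.finite_toSet.image t)
    _ ≤ (s : Set A).ncard := Set.ncard_image_le s.finite_toSet
    _ = s.card := Set.ncard_coe_finset s

variable {k : Type u} [Field k] [IsAlgClosed k] {X : Scheme.{u}}

theorem exists_tangentDim_le_of_isAffineOpen (π : X ⟶ Spec (.of k)) [LocallyOfFiniteType π]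
    {U : X.Opens} (hU : IsAffineOpen U) :
    ∃ n, ∀ x ∈ U, IsClosed {x} → tangentDim X x ≤ n := by
  have : IsLocallyNoetherian X := LocallyOfFiniteType.isLocallyNoetherian π
  let e : U ≤ π ⁻¹ᵁ ⊤ := le_top
  let f : CommRingCat.of k ⟶ Γ(X, U) := (Scheme.ΓSpecIso (.of k)).inv ≫ π.appLE ⊤ U e
  have hf : f.hom.FiniteType := by
    refine RingHom.FiniteType.comp (π.finiteType_appLE (isAffineOpen_top _) hU e) ?_
    exact RingHom.FiniteType.of_surjective _
      ((ConcreteCategory.isIso_iff_bijective (Scheme.ΓSpecIso (.of k)).inv).1 inferInstance).2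
  have hfπ : Spec.map f = hU.fromSpec ≫ π := by
    rw [Spec.map_comp, ← Scheme.isoSpec_Spec_inv, ← IsAffineOpen.fromSpec_top,
      IsAffineOpen.SpecMap_appLE_fromSpec]
  let _ : Algebra k Γ(X, U) := f.hom.toAlgebra
  obtain ⟨s, hs⟩ := (show Algebra.FiniteType k Γ(X, U) from hf).out
  refine ⟨s.card, fun x hxU hx => ?_⟩
  have hk := (bijective_algebraMap_residueField π hx).surjective
  let _ : Algebra Γ(X, U) (X.presheaf.stalk x) := (X.presheaf.germ U x hxU).hom.toAlgebra
  have := hU.isLocalization_stalk ⟨x, hxU⟩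
  have hcomp : Spec.preimage (X.fromSpecStalk x ≫ π) = f ≫ X.presheaf.germ U x hxU := by
    apply Spec.map_injective
    rw [Spec.map_preimage, Spec.map_comp, hfπ, ← Category.assoc,
      ← hU.fromSpecStalk_eq_fromSpecStalk hxU]
    rfl
  have hk' : Function.Surjective ((IsLocalRing.residue (X.presheaf.stalk x)).comp
      ((algebraMap Γ(X, U) (X.presheaf.stalk x)).comp (algebraMap k Γ(X, U)))) := by
    have : (IsLocalRing.residue (X.presheaf.stalk x)).comp
        (Spec.preimage (X.fromSpecStalk x ≫ π)).hom = (IsLocalRing.residue _).comp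
          ((algebraMap Γ(X, U) (X.presheaf.stalk x)).comp (algebraMap k Γ(X, U))) := by
      rw [hcomp]; rfl
    rw [← this]
    exact hk
  rw [tangentDim, Subspace.dual_finrank_eq,
    ← IsLocalRing.spanFinrank_maximalIdeal_eq_finrank_cotangentSpace]
  exact IsLocalRing.spanFinrank_maximalIdeal_le_card
    (hU.primeIdealOf ⟨x, hxU⟩).asIdeal s hs hk'

theorem exists_tangentDim_le (π : X ⟶ Spec (.of k)) [LocallyOfFiniteType π] [CompactSpace X] :
    ∃ n, ∀ x : X, IsClosed {x} → tangentDim X x ≤ n := by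
  have := isCompact_univ (X := X).induction_on
    (p := fun S : Set X => ∃ n, ∀ x ∈ S, IsClosed {x} → tangentDim X x ≤ n)
    ⟨0, by simp⟩ (fun S T hST ⟨n, hn⟩ => ⟨n, fun x hx => hn x (hST hx)⟩)
    (fun S T ⟨n, hn⟩ ⟨l, hl⟩ => ⟨max n l, fun x hx hxc => hx.elim
      (fun h => (hn x h hxc).trans (le_max_left _ _))
      fun h => (hl x h hxc).trans (le_max_right _ _)⟩)
    (fun x _ => by
      obtain ⟨U, hU, hxU, -⟩ := exists_isAffineOpen_mem_and_subset (U := ⊤) (Set.mem_univ x)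
      exact ⟨U, mem_nhdsWithin_of_mem_nhds (U.isOpen.mem_nhds hxU),
        exists_tangentDim_le_of_isAffineOpen π hU⟩)
  obtain ⟨n, hn⟩ := this
  exact ⟨n, fun x => hn x (Set.mem_univ x)⟩

end TangentDimension

/-! ### Conclusion -/

theorem jordanBound_jordanConstant {G : Type*} [Group G] (h : IsJordanGroup G) :
    0 < jordanConstant G ∧ JordanBound G (jordanConstant G) :=
  Nat.sInf_mem h

theorem mainTheorem5 {k : Type u} [Field k] [IsAlgClosed k] [CharZero k]
    {X : Scheme.{u}} (π : X ⟶ Spec (.of k)) (hX : IsAlgebraicVariety π)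
    (hirr : IrreducibleSpace X) :
    IsGreatest (Set.range fun x : VarietyPoint X => tangentDim X x.1) (maxTangentDim X) ∧
    (∀ G : Subgroup (VarietyAut π), Finite G → HasFixedPoint G →
      ∃ A : Subgroup G, A.Normal ∧ IsMulCommutative A ∧
        A.index ≤ jordanConstant (GL (Fin (maxTangentDim X)) k)) ∧
    ((∀ G : Subgroup (VarietyAut π), Finite G → HasFixedPoint G) →
      IsJordanGroup (VarietyAut π) ∧
        jordanConstant (VarietyAut π) ≤ jordanConstant (GL (Fin (maxTangentDim X)) k)) := by
  have := hX.locallyOfFiniteType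
  have := hX.quasiCompact
  have : CompactSpace X := QuasiCompact.compactSpace_of_compactSpace π
  have hne : Nonempty (VarietyPoint X) := by
    obtain ⟨x, -, hx⟩ := isClosed_univ.exists_closed_singleton (Set.univ_nonempty (α := X))
    exact ⟨x, hx⟩
  have hbdd : BddAbove (Set.range fun x : VarietyPoint X => tangentDim X x.1) := by
    obtain ⟨n, hn⟩ := exists_tangentDim_le π
    refine ⟨n, ?_⟩
    rintro _ ⟨x, rfl⟩
    exact hn x.1 x.2
  have hmax : IsGreatest (Set.range fun x : VarietyPoint X => tangentDim X x.1)
      (maxTangentDim X) :=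
    ⟨Nat.sSup_mem (Set.range_nonempty _) hbdd, fun _ h => le_csSup hbdd h⟩
  -- Jordan's theorem excludes the default value `0` of `jordanConstant`, so the infimum is itself
  -- an admissible bound.
  obtain ⟨hpos, hbound⟩ := jordanBound_jordanConstant
    (G := GL (Fin (maxTangentDim X)) k) ⟨_, by positivity, jordanBound_generalLinearGroup k _⟩
  have hfix : ∀ G : Subgroup (VarietyAut π), Finite G → HasFixedPoint G →
      ∃ A : Subgroup G, A.Normal ∧ IsMulCommutative A ∧
        A.index ≤ jordanConstant (GL (Fin (maxTangentDim X)) k) := by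
    rintro G hG ⟨x, hx⟩
    obtain ⟨F, hF⟩ := exists_injective_generalLinearGroup_of_fixed hX G x.2 hx
      (hmax.2 ⟨x, rfl⟩)
    exact hbound.exists_of_injective F hF
  refine ⟨hmax, hfix, fun h => ?_⟩
  have hAut : JordanBound (VarietyAut π) (jordanConstant (GL (Fin (maxTangentDim X)) k)) :=
    fun G hG => hfix G hG (h G hG)
  exact ⟨⟨_, hpos, hAut⟩, Nat.sInf_le ⟨hpos, hAut⟩⟩
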